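/- **Conventions.** All indices are taken modulo $n$. For $n\ge 3$ let $V=[n]\times\{0,1,01,11\}$ and $N=|V|=4n$. For $x,y\in\{0,1\}^n$ define directed graphs on $V$ with the following edges: - $E_A(x)$ consists of the edges $(i,1)\to(i+1,z)$ for all $i$, where $z=0$ if $x_{i+1}=0$ and $z=11$ otherwise; the edges $(i,0)\to(i+1,z)$ for all $i$ with $x_i=0$, where $z=0$ if $x_{i+1}=0$ and $z=01$ otherwise; the edges $(i,0)\to(i-1,x_{i-1})$ for all $i$ with $x_i=1$; and the edges $(i,01)\to(i,1)$ and $(i,11)\to(i,1)$ for all $i$. - $E_B(y)$ consists of the edges $(i,1)\to(i+1,z)$ for all $i$, where $z=0$ if $y_{i+1}=0$ and $z=11$ otherwise; the edges $(i,0)\to(i+1,z)$ for all $i$, where $z=0$ if $y_{i+1}=0$ and $z=01$ otherwise; and the edges $(i,01)\to(i,1)$ and $(i,11)\to(i,1)$ for all $i$. A *2-cycle $N\times N$ game* is a two-player win-lose game in which both players have the action set $V$, with utilities $u_A(u,v)=1$ if $(v,u)\in E_A(x)$ and $0$ otherwise, and $u_B(u,v)=1$ if $(u,v)\in E_B(y)$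 and $0$ otherwise, for some strings $x,y\in\{0,1\}^n$ such that there is exactly one index $i$ with $x_i>y_i$. A pair $(a^*,b^*)$ of probability distributions on $V$ is an *$\varepsilon$-approximate Nash equilibrium* if $\mathbb E_{u\sim a,v\sim b^*}[u_A(u,v)]-\mathbb E_{u\sim a^*,v\sim b^*}[u_A(u,v)]\le\varepsilon$ for every distribution $a$ on $V$, and $\mathbb E_{u\sim a^*,v\sim b}[u_B(u,v)]-\mathbb E_{u\sim a^*,v\sim b^*}[u_B(u,v)]\le\varepsilon$ for every distribution $b$ on $V$. A *randomized protocol* is a two-party communication protocol in which the players may use common and private random coins. Player $A$ is given $u_A$ and player $B$ is given $u_B$; they exchange bits, and at the end $A$ outputs a distribution $a^*$ and $B$ outputs a distribution $b^*$. It *finds an $\varepsilon$-approximate Nash equilibrium of the 2-cycle $N\times N$ game with error probability at most $\delta$* if, for every 2-cycle $N\times N$ game $(u_A,u_B)$, the probability over the coins that $(a^*,b^*)$ is not an $\varepsilon$-approximate Nash equilibrium of that game is at most $\delta$. Its *communication complexity* is the maximum, over all 2-cycle $N\times N$ games and all outcomes of the coins, of the total number of bits exchanged. **Theorem.** There is an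 absolute constant $c>0$ such that for every $n\ge 3$, with $N=4n$, and every $0\le\varepsilon\le\frac1{16N^2}$, every randomized protocol that finds an $\varepsilon$-approximate Nash equilibrium of the 2-cycle $N\times N$ game with error probability at most $\frac13$ has communication complexity at least $cN$. -/

import Mathlib

open MeasureTheory
open scoped ENNReal

universe w u

/-! ## Two-party communication protocols -/

/-- A (deterministic) two-party protocol tree. Player `A` holds an element of `X` and player `B` an
element of `Y`. At an inner node one of the players sends one bit, computed from what that player
holds; the position in the tree records the transcript so far. At a leaf (which is reached by a
given transcript) player `A` outputs an element of `α` and player `B` an element of `β`, each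
computed from what that player holds. -/
inductive Protocol (X Y α β : Type*) where
  | output (outA : X → α) (outB : Y → β) : Protocol X Y α β
  | sendA (msg : X → Bool) (next : Bool → Protocol X Y α β) : Protocol X Y α β
  | sendB (msg : Y → Bool) (next : Bool → Protocol X Y α β) : Protocol X Y α β

namespace Protocol

variable {X Y α β : Type*}

/-- The pair of outputs of the two players when the protocol is run on `(x, y)`. -/
def run : Protocol X Y α β → X → Y → α × β
  | output outA outB, x, y => (outA x, outB y)
  | sendA msg next, x, y => (next (msg x)).run x y
  | sendB msg next, x, y => (next (msg y)).run x y

/-- The number of bits communicated when the protocol is run on `(x, y)`. -/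
def bits : Protocol X Y α β → X → Y → ℕ
  | output _ _, _, _ => 0
  | sendA msg next, x, y => (next (msg x)).bits x y + 1
  | sendB msg next, x, y => (next (msg y)).bits x y + 1

end Protocol

/-- A randomized two-party protocol with common and private random coins. The common coins, the
private coins of `A` and the private coins of `B` are drawn independently from arbitrary
probability spaces. The common coins select a protocol tree, and in that tree each player acts on
the own input and the own private coins. -/
structure RandomizedProtocol (X Y α β : Type u) where
  /-- values of the common coins -/
  Pub : Type w
  /-- values of the private coins of player `A` -/
  PrivA : Type w
  /-- values of the private coins of player `B` -/
  PrivB : Type w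
  [measPub : MeasurableSpace Pub]
  [measPrivA : MeasurableSpace PrivA]
  [measPrivB : MeasurableSpace PrivB]
  pubLaw : ProbabilityMeasure Pub
  privALaw : ProbabilityMeasure PrivA
  privBLaw : ProbabilityMeasure PrivB
  tree : Pub → Protocol (X × PrivA) (Y × PrivB) α β

namespace RandomizedProtocol

variable {X Y α β : Type u}

attribute [instance] measPub measPrivA measPrivB

/-- The joint law of all coins. -/
noncomputable def coinLaw (P : RandomizedProtocol.{w} X Y α β) :
    Measure (P.Pub × P.PrivA × P.PrivB) :=
  (P.pubLaw : Measure P.Pub).prod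
    ((P.privALaw : Measure P.PrivA).prod (P.privBLaw : Measure P.PrivB))

/-- The outputs of the players on input `(x, y)` with coins `r`. -/
def run (P : RandomizedProtocol.{w} X Y α β) (x : X) (y : Y) (r : P.Pub × P.PrivA × P.PrivB) : α × β :=
  (P.tree r.1).run (x, r.2.1) (y, r.2.2)

/-- The number of bits communicated on input `(x, y)` with coins `r`. -/
def bits (P : RandomizedProtocol.{w} X Y α β) (x : X) (y : Y) (r : P.Pub × P.PrivA × P.PrivB) : ℕ :=
  (P.tree r.1).bits (x, r.2.1) (y, r.2.2)

/-- On every input pair allowed by `promise`, the probability that the pair of outputs fails to be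
a correct answer is at most `δ`. (For an event that is not measurable, `coinLaw` gives its outer
measure, so that the good event has inner measure at least `1 - δ`.) -/
def SolvesWithError (P : RandomizedProtocol.{w} X Y α β) (promise : X → Y → Prop)
    (correct : X → Y → α → β → Prop) (δ : ℝ≥0∞) : Prop :=
  ∀ x y, promise x y →
    P.coinLaw {r | ¬ correct x y (P.run x y r).1 (P.run x y r).2} ≤ δ

/-- The communication complexity of a protocol: the largest number of bits communicated on an
allowed input pair, over all outcomes of the coins (`⊤` if there is no largest number). -/
noncomputable def cost (P : RandomizedProtocol.{w} X Y α β) (promise : X → Y → Prop) : ℕ∞ :=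
  ⨆ (x : X) (y : Y) (_ : promise x y) (r : P.Pub × P.PrivA × P.PrivB), (P.bits x y r : ℕ∞)

end RandomizedProtocol

/-! ## Win-lose games and approximate Nash equilibria -/

section Games

variable {U V : Type*} [Fintype U] [Fintype V]

/-- The expected payoff under the mixed strategies `a`, `b`, for the win-lose utility function `w`
(`true` is payoff 1 and `false` is payoff 0). -/
noncomputable def expectedPayoff (w : U → V → Bool) (a : stdSimplex ℝ U) (b : stdSimplex ℝ V) : ℝ :=
  ∑ u, ∑ v, a.1 u * b.1 v * (if w u v = true then 1 else 0)

/-- `(a, b)` is an `ε`-approximate Nash equilibrium of the win-lose game `(uA, uB)`. -/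
def IsApproxNash (ε : ℝ) (uA uB : U → V → Bool) (a : stdSimplex ℝ U) (b : stdSimplex ℝ V) : Prop :=
  (∀ a' : stdSimplex ℝ U, expectedPayoff uA a' b - expectedPayoff uA a b ≤ ε) ∧
  (∀ b' : stdSimplex ℝ V, expectedPayoff uB a b' - expectedPayoff uB a b ≤ ε)

end Games

/-! ## The 2-cycle game -/

namespace TwoCycle

/-- The strings `0`, `1`, `01`, `11`. -/
inductive Label where
  | s0 | s1 | s01 | s11
  deriving DecidableEq

instance : Fintype Label where
  elems := {.s0, .s1, .s01, .s11}
  complete := by intro z; cases z <;> simp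

/-- The vertices of the graphs, which are also the actions of each player. -/
abbrev Vertex (n : ℕ) : Type := ZMod n × Label

theorem card_vertex (n : ℕ) [NeZero n] : Fintype.card (Vertex n) = 4 * n := by
  have h : Fintype.card Label = 4 := rfl
  rw [Fintype.card_prod, ZMod.card, h, mul_comm]

variable {n : ℕ}

/-- A single bit as a label. -/
def bitLabel (b : Bool) : Label := if b = true then .s1 else .s0

/-- The directed edges of the graph of player `A` for the string `x`. -/
def edgesA (x : ZMod n → Bool) : Set (Vertex n × Vertex n) :=
  {e | ∃ i, e = ((i, .s1), (i + 1, if x (i + 1) = false then .s0 else .s11))} ∪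
  {e | ∃ i, x i = false ∧ e = ((i, .s0), (i + 1, if x (i + 1) = false then .s0 else .s01))} ∪
  {e | ∃ i, x i = true ∧ e = ((i, .s0), (i - 1, bitLabel (x (i - 1))))} ∪
  {e | ∃ i, e = ((i, .s01), (i, .s1)) ∨ e = ((i, .s11), (i, .s1))}

/-- The directed edges of the graph of player `B` for the string `y`. -/
def edgesB (y : ZMod n → Bool) : Set (Vertex n × Vertex n) :=
  {e | ∃ i, e = ((i, .s1), (i + 1, if y (i + 1) = false then .s0 else .s11))} ∪
  {e | ∃ i, e = ((i, .s0), (i + 1, if y (i + 1) = false then .s0 else .s01))} ∪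
  {e | ∃ i, e = ((i, .s01), (i, .s1)) ∨ e = ((i, .s11), (i, .s1))}

open Classical in
/-- The utility function of player `A`: payoff 1 at `(u, v)` iff `(v, u)` is an edge for `A`. -/
noncomputable def utilityA (x : ZMod n → Bool) (u v : Vertex n) : Bool :=
  decide ((v, u) ∈ edgesA x)

open Classical in
/-- The utility function of player `B`: payoff 1 at `(u, v)` iff `(u, v)` is an edge for `B`. -/
noncomputable def utilityB (y : ZMod n → Bool) (u v : Vertex n) : Bool :=
  decide ((u, v) ∈ edgesB y)

/-- `(uA, uB)` is a 2-cycle game: it is constructed from two `n`-bit strings `x`, `y` with exactly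
one index `i` such that `x i > y i`. -/
def IsGame (uA uB : Vertex n → Vertex n → Bool) : Prop :=
  ∃ x y : ZMod n → Bool, (∃! i, x i = true ∧ y i = false) ∧ uA = utilityA x ∧ uB = utilityB y

end TwoCycle

/-! The hardness comes from finding the unique common element of two sets. In each graph a vertex
has one successor and at most three predecessors, and a player is paid for playing the successor of
the opponent's action. At accuracy `1 / (16 N ^ 2)` every action of weight above `1 / (4 N)` is
therefore the successor of an opponent action of such weight (`exists_heavy_of_best_response`). So
the heavy actions of `A` lie in every iterated image of the composed successor map. That map
advances around the cycle until it is trapped just before the special index `i`, where `x i = 1` and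
`y i = 0`. Hence the strategy of `A` alone reveals `i` (`reveals_of_isApproxNash`), and `i` is the
common element of the set coded by `x` and the set coded by the complement of `y`.

For the lower bound, fix coins that are good on average; a tree of depth `C` becomes a partition
into at most `2 ^ C` rectangles. A random mask `D` gives every element to only one of the players,
so the masked inputs are disjoint and, given `D`, independent. The entropy of the transcript is at
most `log |L|`; by the level-1 inequality it controls the total squared Hellinger change when one
player's bit is planted (`expect_sum_transcriptGap_le`). Cut-and-paste transfers this to planting
both bits: at an average coordinate the transcript on the intersecting input `11` is close to that
on `10`. But on disjoint inputs a single guess cannot hit the planted coordinate for many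
coordinates, so `|L|` is exponential in the number of elements (`card_le_of_find_planted`). -/

/-! ### Protocol trees and averaging over coins -/

/-- A protocol tree that is cut at depth `C` partitions the inputs into at most `2 ^ C` rectangles
on each of which the output of player `A` depends on the input of player `A` only. -/
theorem Protocol.exists_rectangles {X Y α β : Type*} [Nonempty α] (C : ℕ) :
    ∀ P : Protocol X Y α β, ∃ (L : Type) (_ : Fintype L) (F : L → X → Prop) (G : L → Y → Prop)
      (out : L → X → α), Fintype.card L ≤ 2 ^ C ∧ (∀ x y, ∃! l, F l x ∧ G l y) ∧
      ∀ x y l, P.bits x y ≤ C → F l x → G l y → (P.run x y).1 = out l x := by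
  induction C with
  | zero =>
    intro P
    -- The arbitrary output at an inner node is harmless: a run reaching it sends a bit, contrary to
    -- the bound `0`.
    refine ⟨Unit, inferInstance, fun _ _ => True, fun _ _ => True,
      match P with
      | .output oA _ => fun _ => oA
      | _ => fun _ _ => Classical.arbitrary α, by simp, by simp, ?_⟩
    intro x y l h _ _
    cases P with
    | output oA oB => rfl
    | sendA msg next => simp [Protocol.bits] at h
    | sendB msg next => simp [Protocol.bits] at h
  | succ C ih =>
    intro P
    cases P with
    | output oA oB =>
      exact ⟨Unit, inferInstance, fun _ _ => True, fun _ _ => True, fun _ => oA,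
        by simpa using Nat.one_le_two_pow, by simp, fun _ _ _ _ _ _ => rfl⟩
    | sendA msg next =>
      choose L hL F G out hc hp ho using fun b => ih (next b)
      refine ⟨Σ b, L b, inferInstance, fun l x => msg x = l.1 ∧ F l.1 l.2 x, fun l y => G l.1 l.2 y,
        fun l x => out l.1 l.2 x, ?_, ?_, ?_⟩
      · have h1 := hc true
        have h2 := hc false
        simp only [Fintype.card_sigma, Fintype.sum_bool, pow_succ]
        omega
      · intro x y
        obtain ⟨l, hl, hu⟩ := hp (msg x) x y
        refine ⟨⟨msg x, l⟩, ⟨⟨rfl, hl.1⟩, hl.2⟩, ?_⟩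
        rintro ⟨b, l'⟩ ⟨⟨h1, h2⟩, h3⟩
        dsimp only at h1 h2 h3
        subst h1
        rw [hu l' ⟨h2, h3⟩]
      · rintro x y ⟨b, l⟩ hb ⟨h1, h2⟩ h3
        dsimp only at h1 h2 h3
        subst h1
        exact ho _ x y l (by simpa [Protocol.bits] using hb) h2 h3
    | sendB msg next =>
      choose L hL F G out hc hp ho using fun b => ih (next b)
      refine ⟨Σ b, L b, inferInstance, fun l x => F l.1 l.2 x, fun l y => msg y = l.1 ∧ G l.1 l.2 y,
        fun l x => out l.1 l.2 x, ?_, ?_, ?_⟩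
      · have h1 := hc true
        have h2 := hc false
        simp only [Fintype.card_sigma, Fintype.sum_bool, pow_succ]
        omega
      · intro x y
        obtain ⟨l, hl, hu⟩ := hp (msg y) x y
        refine ⟨⟨msg y, l⟩, ⟨hl.1, rfl, hl.2⟩, ?_⟩
        rintro ⟨b, l'⟩ ⟨h2, h1, h3⟩
        dsimp only at h1 h2 h3
        subst h1
        rw [hu l' ⟨h2, h3⟩]
      · rintro x y ⟨b, l⟩ hb h2 ⟨h1, h3⟩
        dsimp only at h1 h2 h3
        subst h1
        exact ho _ x y l (by simpa [Protocol.bits] using hb) h2 h3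

/-- A protocol without communication computes the output of player `A` from that player's input. -/
theorem Protocol.run_fst_eq_of_bits_eq_zero {X Y α β : Type*} (P : Protocol X Y α β) {x : X}
    {y y' : Y} (h : P.bits x y = 0) : (P.run x y).1 = (P.run x y').1 := by
  cases P with
  | output oA oB => rfl
  | sendA msg next => simp [Protocol.bits] at h
  | sendB msg next => simp [Protocol.bits] at h

open Classical in
/-- Averaging over the coins: on a finite family of allowed inputs, some outcome of the coins makes
the protocol fail on at most a fraction `δ` of the family. -/
theorem RandomizedProtocol.SolvesWithError.exists_coins {X Y α β : Type u}
    {P : RandomizedProtocol.{w} X Y α β} {promise : X → Y → Prop} {correct : X → Y → α → β → Prop}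
    {δ : ℝ≥0∞} (h : P.SolvesWithError promise correct δ) {Ω : Type*} [Fintype Ω] (x : Ω → X)
    (y : Ω → Y) (hxy : ∀ ω, promise (x ω) (y ω)) :
    ∃ r, ((Finset.univ.filter fun ω =>
      ¬ correct (x ω) (y ω) (P.run (x ω) (y ω) r).1 (P.run (x ω) (y ω) r).2).card : ℝ≥0∞)
        ≤ Fintype.card Ω * δ := by
  have : IsProbabilityMeasure P.coinLaw := by
    unfold RandomizedProtocol.coinLaw; infer_instance
  set bad : Ω → Set (P.Pub × P.PrivA × P.PrivB) := fun ω =>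
    {r | ¬ correct (x ω) (y ω) (P.run (x ω) (y ω) r).1 (P.run (x ω) (y ω) r).2} with hbad
  -- The failure events need not be measurable, so each is replaced by a measurable superset of the
  -- same measure before integrating.
  set f : P.Pub × P.PrivA × P.PrivB → ℝ≥0∞ := fun r =>
    ∑ ω, (toMeasurable P.coinLaw (bad ω)).indicator 1 r with hf
  have hm : ∀ ω, Measurable ((toMeasurable P.coinLaw (bad ω)).indicator
      (1 : P.Pub × P.PrivA × P.PrivB → ℝ≥0∞)) := fun ω =>
    measurable_one.indicator (measurableSet_toMeasurable _ _)
  have hfm : Measurable f := Finset.measurable_fun_sum _ fun ω _ => hm ω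
  obtain ⟨r, hr⟩ := exists_le_lintegral (μ := P.coinLaw) hfm.aemeasurable
  refine ⟨r, ?_⟩
  have hint : ∫⁻ a, f a ∂P.coinLaw ≤ Fintype.card Ω * δ := by
    rw [hf, lintegral_finsetSum _ fun ω _ => hm ω]
    calc ∑ ω, ∫⁻ a, (toMeasurable P.coinLaw (bad ω)).indicator 1 a ∂P.coinLaw
        ≤ ∑ _ω : Ω, δ := Finset.sum_le_sum fun ω _ => by
          rw [lintegral_indicator_one (measurableSet_toMeasurable _ _), measure_toMeasurable]
          exact h _ _ (hxy ω)
      _ = _ := by simp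
  refine le_trans ?_ (hr.trans hint)
  rw [Finset.card_filter, Nat.cast_sum, hf]
  refine Finset.sum_le_sum fun ω _ => ?_
  by_cases hω : r ∈ bad ω
  · rw [Set.indicator_of_mem (subset_toMeasurable _ _ hω)]
    simp only [Pi.one_apply]
    split_ifs <;> simp
  · have : correct (x ω) (y ω) (P.run (x ω) (y ω) r).1 (P.run (x ω) (y ω) r).2 := by
      by_contra hc; exact hω hc
    simp [this]

open Real Finset
open scoped BigOperators

/-! ### Masked bit strings -/

section Mask

/-- The bits of `U` at the positions selected by `D`, with the other bits set to `false`. -/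
def bitMask {ι : Type*} (U D : ι → Bool) : ι → Bool := fun j => U j && D j

variable {ι : Type*} [DecidableEq ι]

theorem bitMask_update_left {D : ι → Bool} {i : ι} (hD : D i = true) (U : ι → Bool) (a : Bool) :
    bitMask (Function.update U i a) D = Function.update (bitMask U D) i a := by
  ext j; by_cases hj : j = i
  · subst hj; simp [bitMask, hD]
  · simp [bitMask, hj]

theorem update_bitMask_update (U D : ι → Bool) (i : ι) (c a : Bool) :
    Function.update (bitMask U (Function.update D i c)) i a
      = Function.update (bitMask U D) i a := by
  ext j; by_cases hj : j = i
  · subst hj; simp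
  · simp [bitMask, hj]

theorem update_bitMask_of_eq_false {D : ι → Bool} {i : ι} (hD : D i = false) (U : ι → Bool) :
    Function.update (bitMask U D) i false = bitMask U D := by
  ext j; by_cases hj : j = i
  · subst hj; simp [bitMask, hD]
  · simp [hj]

end Mask

/-! ### Level-1 inequality and Hellinger gaps on the cube -/

section Cube

variable {ι : Type*} [Fintype ι] [DecidableEq ι]

/-- The bit `true` as `1` and the bit `false` as `-1`. -/
def boolSign (b : Bool) : ℝ := if b then 1 else -1

/-- Splitting a uniform average over the cube according to one coordinate. -/
theorem expect_cube_split (i : ι) (h : (ι → Bool) → ℝ) :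
    𝔼 U, h U = (𝔼 U, h (Function.update U i true) + 𝔼 U, h (Function.update U i false)) / 2 := by
  have hinv : Function.Involutive fun U : ι → Bool => Function.update U i (!U i) := by
    intro U; ext j; by_cases hj : j = i
    · subst hj; simp
    · simp [hj]
  have h1 : 𝔼 U, h (Function.update U i (!U i)) = 𝔼 U, h U :=
    Fintype.expect_equiv hinv.toPerm _ _ fun U => rfl
  have h2 : ∀ U : ι → Bool, h (Function.update U i true) + h (Function.update U i false)
      = h U + h (Function.update U i (!U i)) := by
    intro U
    have h3 : h (Function.update U i (U i)) = h U := by rw [Function.update_eq_self]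
    rw [← h3]
    cases U i <;> simp [add_comm]
  rw [← Finset.expect_add_distrib, Finset.expect_congr rfl fun U _ => h2 U,
    Finset.expect_add_distrib, h1]
  ring

/-- The uniform average of a product of functions of single coordinates. -/
theorem expect_cube_prod (f : ι → Bool → ℝ) :
    𝔼 U : ι → Bool, ∏ i, f i (U i) = ∏ i, (f i true + f i false) / 2 := by
  have h := Finset.prod_univ_sum (fun _ : ι => (Finset.univ : Finset Bool)) f
  simp only [Fintype.piFinset_univ, Fintype.sum_bool] at h
  rw [Fintype.expect_eq_sum_div_card, ← h, Finset.prod_div_distrib]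
  simp

/-- The level-1 inequality. -/
theorem sum_sq_expect_boolSign_le (φ : (ι → Bool) → ℝ) (h0 : ∀ U, 0 ≤ φ U) (h1 : ∀ U, φ U ≤ 1) :
    ∑ i, (𝔼 U, φ U * boolSign (U i)) ^ 2 ≤ 2 * (𝔼 U, φ U) * negMulLog (𝔼 U, φ U) := by
  set q := 𝔼 U, φ U with hq
  set b : ι → ℝ := fun i => 𝔼 U, φ U * boolSign (U i) with hb
  have hq0 : 0 ≤ q := Finset.expect_nonneg fun U _ => h0 U
  have hbq : ∀ i, |b i| ≤ q := by
    intro i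
    rw [abs_le]
    constructor
    · rw [hq, hb, ← Finset.expect_neg_distrib]
      refine Finset.expect_le_expect fun U _ => ?_
      have := h0 U
      rcases h : U i <;> simp only [boolSign] <;> norm_num <;> linarith
    · refine Finset.expect_le_expect fun U _ => ?_
      have := h0 U
      rcases h : U i <;> simp only [boolSign] <;> norm_num <;> linarith
  rcases hq0.eq_or_lt with hz | hpos
  · have : ∀ i, b i = 0 := fun i => by
      have := hbq i; rw [← hz] at this; exact abs_nonpos_iff.1 this
    change ∑ i, (b i) ^ 2 ≤ _
    simp [this, ← hz]
  set β : ι → ℝ := fun i => b i / q with hβ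
  set Q := ∑ i, β i ^ 2 with hQ
  set t : (ι → Bool) → ℝ := fun U => ∑ i, β i * boolSign (U i) with ht
  have hφt : 𝔼 U, φ U * t U = q * Q := by
    have : ∀ U, φ U * t U = ∑ i, β i * (φ U * boolSign (U i)) := by
      intro U; rw [ht, Finset.mul_sum]; exact Finset.sum_congr rfl fun i _ => by ring
    rw [Finset.expect_congr rfl fun U _ => this U, Finset.expect_sum_comm, hQ, Finset.mul_sum]
    refine Finset.sum_congr rfl fun i _ => ?_
    rw [← Finset.mul_expect]
    change β i * b i = _
    rw [hβ]; field_simp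
  -- Jensen for the law with density `φ / q`, under which `t` has mean `Q`, via the tangent `exp t ≥
  -- exp Q * (1 + t - Q)`.
  have hlow : q * exp Q ≤ 𝔼 U, φ U * exp (t U) := by
    have : q * exp Q = 𝔼 U, (exp Q * (φ U * t U) + exp Q * (1 - Q) * φ U) := by
      rw [Finset.expect_add_distrib, ← Finset.mul_expect, ← Finset.mul_expect, hφt, ← hq]; ring
    rw [this]
    refine Finset.expect_le_expect fun U _ => ?_
    have h2 := Real.add_one_le_exp (t U - Q)
    have h3 : exp (t U) = exp Q * exp (t U - Q) := by rw [← Real.exp_add]; congr 1; ring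
    rw [h3]
    have h4 : exp Q * (t U - Q + 1) ≤ exp Q * exp (t U - Q) :=
      mul_le_mul_of_nonneg_left h2 (exp_pos _).le
    nlinarith [mul_le_mul_of_nonneg_left h4 (h0 U)]
  -- Dropping `φ ≤ 1` leaves the moment generating function of a weighted sum of independent signs.
  have hup : 𝔼 U, φ U * exp (t U) ≤ exp (Q / 2) := by
    calc 𝔼 U, φ U * exp (t U) ≤ 𝔼 U : ι → Bool, ∏ i, exp (β i * boolSign (U i)) :=
          Finset.expect_le_expect fun U _ => by
            rw [← Real.exp_sum]
            exact mul_le_of_le_one_left (exp_pos _).le (h1 U)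
      _ = ∏ i, Real.cosh (β i) := by
          rw [expect_cube_prod fun i c => exp (β i * boolSign c)]
          refine Finset.prod_congr rfl fun i _ => ?_
          simp [boolSign, Real.cosh_eq]
      _ ≤ ∏ i, exp (β i ^ 2 / 2) :=
          Finset.prod_le_prod (fun i _ => (Real.cosh_pos _).le) fun i _ =>
            Real.cosh_le_exp_half_sq _
      _ = exp (Q / 2) := by rw [← Real.exp_sum, hQ, Finset.sum_div]
  have hlog : Q / 2 ≤ -Real.log q := by
    have h2 : q * exp (Q / 2) ≤ 1 := by
      have h3 := hlow.trans hup
      have h4 : exp Q = exp (Q / 2) * exp (Q / 2) := by rw [← Real.exp_add]; congr 1; ring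
      rw [h4] at h3
      have := exp_pos (Q / 2)
      by_contra hc
      push Not at hc
      nlinarith
    have h3 := Real.log_le_log (by positivity) h2
    rw [Real.log_mul hpos.ne' (exp_pos _).ne', Real.log_exp, Real.log_one] at h3
    linarith
  have hsum : ∑ i, (b i) ^ 2 = q ^ 2 * Q := by
    rw [hQ, Finset.mul_sum]
    refine Finset.sum_congr rfl fun i _ => ?_
    rw [hβ]; field_simp
  change ∑ i, (b i) ^ 2 ≤ _
  rw [hsum, negMulLog]
  nlinarith [mul_le_mul_of_nonneg_left hlog (sq_nonneg q)]

/-- The average of `F` over masked strings in which bit `i` is set to `a`. -/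
noncomputable def plantedMean (F : (ι → Bool) → ℝ) (D : ι → Bool) (i : ι) (a : Bool) : ℝ :=
  𝔼 U, F (Function.update (bitMask U D) i a)

theorem plantedMean_update (F : (ι → Bool) → ℝ) (D : ι → Bool) (i : ι) (c a : Bool) :
    plantedMean F (Function.update D i c) i a = plantedMean F D i a := by
  simp only [plantedMean, update_bitMask_update]

theorem plantedMean_nonneg {F : (ι → Bool) → ℝ} (h0 : ∀ U, 0 ≤ F U) (D : ι → Bool) (i : ι)
    (a : Bool) : 0 ≤ plantedMean F D i a :=
  Finset.expect_nonneg fun _ _ => h0 _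

theorem expect_bitMask_of_eq_true (F : (ι → Bool) → ℝ) {D : ι → Bool} {i : ι} (hD : D i = true) :
    𝔼 U, F (bitMask U D) = (plantedMean F D i true + plantedMean F D i false) / 2 := by
  rw [expect_cube_split i]
  simp only [bitMask_update_left hD, plantedMean]

theorem expect_bitMask_of_eq_false (F : (ι → Bool) → ℝ) {D : ι → Bool} {i : ι}
    (hD : D i = false) : 𝔼 U, F (bitMask U D) = plantedMean F D i false := by
  simp only [plantedMean, update_bitMask_of_eq_false hD]

theorem expect_bitMask_mul_boolSign (F : (ι → Bool) → ℝ) {D : ι → Bool} {i : ι}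
    (hD : D i = true) : 𝔼 U, F (bitMask U D) * boolSign (U i)
      = (plantedMean F D i true - plantedMean F D i false) / 2 := by
  rw [expect_cube_split i]
  simp only [bitMask_update_left hD, plantedMean, Function.update_self, boolSign]
  simp [Finset.expect_neg_distrib, sub_eq_add_neg]

/-- The squared difference of the square roots of the two planted means at coordinate `i`. -/
noncomputable def sqrtGap (F : (ι → Bool) → ℝ) (D : ι → Bool) (i : ι) : ℝ :=
  (√(plantedMean F D i true) - √(plantedMean F D i false)) ^ 2

theorem sqrtGap_update (F : (ι → Bool) → ℝ) (D : ι → Bool) (i : ι) (c : Bool) :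
    sqrtGap F (Function.update D i c) i = sqrtGap F D i := by
  simp only [sqrtGap, plantedMean_update]

/-- With `s`, `t` the roots of the planted means, this is `(s - t)² (s² + t²) ≤ (s - t)² (s + t)²`.
-/
theorem sqrtGap_mul_expect_le {F : (ι → Bool) → ℝ} (h0 : ∀ U, 0 ≤ F U) {D : ι → Bool} {i : ι}
    (hD : D i = true) : sqrtGap F D i * 𝔼 U, F (bitMask U D)
      ≤ 2 * (𝔼 U, F (bitMask U D) * boolSign (U i)) ^ 2 := by
  rw [expect_bitMask_mul_boolSign F hD, expect_bitMask_of_eq_true F hD, sqrtGap]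
  have hs := Real.sq_sqrt (plantedMean_nonneg h0 D i true)
  have ht := Real.sq_sqrt (plantedMean_nonneg h0 D i false)
  have hs0 := Real.sqrt_nonneg (plantedMean F D i true)
  have ht0 := Real.sqrt_nonneg (plantedMean F D i false)
  set s := √(plantedMean F D i true)
  set t := √(plantedMean F D i false)
  rw [← hs, ← ht]
  have : 0 ≤ (s - t) ^ 2 * (s * t) := by positivity
  nlinarith

/-- The level-1 inequality for the masked function bounds the sum of gaps times the mean `q` by `4 q
* negMulLog q`, and `q` cancels. If `q = 0`, both planted means vanish at each unmasked coordinate.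
-/
theorem sum_sqrtGap_le {F : (ι → Bool) → ℝ} (h0 : ∀ U, 0 ≤ F U) (h1 : ∀ U, F U ≤ 1)
    (D : ι → Bool) :
    ∑ i, (if D i = true then sqrtGap F D i else 0) ≤ 4 * negMulLog (𝔼 U, F (bitMask U D)) := by
  set q := 𝔼 U, F (bitMask U D) with hq
  have hq0 : 0 ≤ q := Finset.expect_nonneg fun U _ => h0 _
  rcases hq0.eq_or_lt with hz | hpos
  · rw [← hz, negMulLog_zero, mul_zero]
    refine (Finset.sum_eq_zero fun i _ => ?_).le
    split_ifs with hD
    · have h2 := expect_bitMask_of_eq_true F hD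
      have h3 := plantedMean_nonneg h0 D i true
      have h4 := plantedMean_nonneg h0 D i false
      rw [← hq, ← hz] at h2
      have h5 : plantedMean F D i true = 0 := by linarith
      have h6 : plantedMean F D i false = 0 := by linarith
      simp [sqrtGap, h5, h6]
    · rfl
  · have hl := sum_sq_expect_boolSign_le (fun U => F (bitMask U D)) (fun _ => h0 _) fun _ => h1 _
    have h2 : (∑ i, (if D i = true then sqrtGap F D i else 0)) * q
        ≤ 2 * ∑ i, (𝔼 U, F (bitMask U D) * boolSign (U i)) ^ 2 := by
      rw [Finset.sum_mul, Finset.mul_sum]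
      refine Finset.sum_le_sum fun i _ => ?_
      split_ifs with hD
      · exact sqrtGap_mul_expect_le h0 hD
      · rw [zero_mul]; positivity
    rw [← hq] at hl
    have h3 : (∑ i, (if D i = true then sqrtGap F D i else 0)) * q ≤ (4 * negMulLog q) * q := by
      linarith
    exact le_of_mul_le_mul_right h3 hpos

end Cube

/-! ### Entropy and cut-and-paste for transcripts -/

/-- The entropy of a distribution on a finite set is at most the logarithm of its size. -/
theorem sum_negMulLog_le_log_card {L : Type*} [Fintype L] (p : L → ℝ) (h0 : ∀ l, 0 ≤ p l)
    (h1 : ∑ l, p l = 1) : ∑ l, negMulLog (p l) ≤ Real.log (Fintype.card L) := by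
  have hne : Nonempty L := by
    by_contra hc
    rw [not_nonempty_iff] at hc
    simp at h1
  have hL : (0 : ℝ) < Fintype.card L := by exact_mod_cast Fintype.card_pos
  set N : ℝ := (Fintype.card L : ℝ) with hN
  have hp : ∀ l, negMulLog (p l) ≤ 1 / N - p l + p l * Real.log N := by
    intro l
    rcases (h0 l).eq_or_lt with hz | hpos
    · rw [← hz]; simp [hL.le]
    · have h2 := Real.log_le_sub_one_of_pos (x := 1 / (p l * N)) (by positivity)
      rw [one_div, Real.log_inv, Real.log_mul hpos.ne' hL.ne'] at h2
      have h3 := mul_le_mul_of_nonneg_left h2 hpos.le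
      have h4 : p l * ((p l * N)⁻¹ - 1) = 1 / N - p l := by field_simp
      rw [h4] at h3
      rw [negMulLog]; nlinarith
  calc ∑ l, negMulLog (p l) ≤ ∑ l, (1 / N - p l + p l * Real.log N) :=
        Finset.sum_le_sum fun l _ => hp l
    _ = Real.log N := by
        rw [Finset.sum_add_distrib, Finset.sum_sub_distrib, ← Finset.sum_mul, h1]
        simp [← hN, hL.ne']

/-- The cut-and-paste argument for the distributions `f · a * g · b` on the set of transcripts. -/
theorem sum_mul_abs_sub_le_of_sum_mul_eq_one {L : Type*} [Fintype L] (f g : L → Bool → ℝ)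
    (hf : ∀ l a, 0 ≤ f l a) (hg : ∀ l b, 0 ≤ g l b) (h : ∀ a b, ∑ l, f l a * g l b = 1) :
    ∑ l, f l true * |g l true - g l false| ≤ 1 / 6 + 36 * ∑ l,
      (g l false * (√(f l true) - √(f l false)) ^ 2
        + f l false * (√(g l true) - √(g l false)) ^ 2) := by
  set s : L → Bool → ℝ := fun l a => √(f l a) with hs
  set t : L → Bool → ℝ := fun l b => √(g l b) with ht
  have hs2 : ∀ l a, f l a = s l a ^ 2 := fun l a => (Real.sq_sqrt (hf l a)).symm
  have ht2 : ∀ l b, g l b = t l b ^ 2 := fun l b => (Real.sq_sqrt (hg l b)).symm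
  have hs0 : ∀ l a, 0 ≤ s l a := fun l a => Real.sqrt_nonneg _
  have ht0 : ∀ l b, 0 ≤ t l b := fun l b => Real.sqrt_nonneg _
  change _ ≤ 1 / 6 + 36 * ∑ l, (g l false * (s l true - s l false) ^ 2
        + f l false * (t l true - t l false) ^ 2)
  simp only [hs2, ht2] at h ⊢
  -- A difference of squares factors as `X * S`, and `X * S ≤ S² / 24 + 6 X²`. The weight is chosen
  -- so that the first terms sum to `1 / 6`.
  have hpt : ∀ l, s l true ^ 2 * |t l true ^ 2 - t l false ^ 2|
      ≤ (s l true ^ 2 * t l true ^ 2 + s l true ^ 2 * t l false ^ 2) / 12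
        + 6 * (s l true * t l true - s l true * t l false) ^ 2 := by
    intro l
    have h1 := hs0 l true
    have h2 := ht0 l true
    have h3 := ht0 l false
    have e : s l true ^ 2 * |t l true ^ 2 - t l false ^ 2|
        = |s l true * t l true - s l true * t l false|
          * (s l true * t l true + s l true * t l false) := by
      rw [← abs_of_nonneg (sq_nonneg (s l true)), ← abs_mul,
        ← abs_of_nonneg (show 0 ≤ s l true * t l true + s l true * t l false by positivity),
        ← abs_mul]
      congr 1; ring
    rw [e, ← sq_abs (s l true * t l true - s l true * t l false)]
    set X := |s l true * t l true - s l true * t l false|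
    nlinarith [sq_nonneg (12 * X - (s l true * t l true + s l true * t l false)),
      sq_nonneg (s l true * t l true - s l true * t l false)]
  have hA : ∑ l, s l true ^ 2 * |t l true ^ 2 - t l false ^ 2|
      ≤ 1 / 6 + 6 * ∑ l, (s l true * t l true - s l true * t l false) ^ 2 := by
    refine (Finset.sum_le_sum fun l _ => hpt l).trans (le_of_eq ?_)
    rw [Finset.sum_add_distrib, ← Finset.mul_sum, ← Finset.sum_div, Finset.sum_add_distrib,
      h, h]
    norm_num
  -- Cut-and-paste: the product form makes the Hellinger affinity of `11` and `00` equal to that of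
  -- `10` and `01`.
  have hcut : ∑ l, (s l true * t l true - s l false * t l false) ^ 2
      = ∑ l, (s l true * t l false - s l false * t l true) ^ 2 := by
    have e : ∀ l, (s l true * t l true - s l false * t l false) ^ 2
        = (s l true * t l false - s l false * t l true) ^ 2
          + (s l true ^ 2 * t l true ^ 2 + s l false ^ 2 * t l false ^ 2
            - s l true ^ 2 * t l false ^ 2 - s l false ^ 2 * t l true ^ 2) := fun l => by ring
    rw [Finset.sum_congr rfl fun l _ => e l, Finset.sum_add_distrib, Finset.sum_sub_distrib,
      Finset.sum_sub_distrib, Finset.sum_add_distrib, h, h, h, h]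
    norm_num
  -- Path from `11` to `10` through `00`; after `hcut`, the leg from `10` to `01` passes through
  -- `00` again. The total is at most `6` times the two gaps at `00`, whence `36`.
  have hB : ∑ l, (s l true * t l true - s l true * t l false) ^ 2
      ≤ ∑ l, (2 * (s l true * t l true - s l false * t l false) ^ 2
        + 2 * (t l false ^ 2 * (s l true - s l false) ^ 2)) :=
    Finset.sum_le_sum fun l _ => by
      nlinarith [sq_nonneg ((s l true * t l true - s l false * t l false)
        + t l false * (s l true - s l false))]
  have hC : ∑ l, (s l true * t l false - s l false * t l true) ^ 2
      ≤ ∑ l, (2 * (t l false ^ 2 * (s l true - s l false) ^ 2)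
        + 2 * (s l false ^ 2 * (t l true - t l false) ^ 2)) :=
    Finset.sum_le_sum fun l _ => by
      nlinarith [sq_nonneg (t l false * (s l true - s l false)
        + s l false * (t l true - t l false))]
  have hn : 0 ≤ ∑ l, s l false ^ 2 * (t l true - t l false) ^ 2 :=
    Finset.sum_nonneg fun l _ => by positivity
  rw [Finset.sum_add_distrib, ← Finset.mul_sum, ← Finset.mul_sum] at hB hC
  rw [Finset.sum_add_distrib]
  linarith

/-! ### Rectangle bound for finding a planted common element -/

section Rectangles

variable {ι L : Type*} [Fintype ι] [DecidableEq ι] [Fintype L]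

/-- The bitwise negation. -/
def bitNot {ι : Type*} (D : ι → Bool) : ι → Bool := fun j => !D j

omit [Fintype ι] in
theorem bitNot_update (D : ι → Bool) (i : ι) (c : Bool) :
    bitNot (Function.update D i c) = Function.update (bitNot D) i (!c) := by
  ext j; by_cases hj : j = i
  · subst hj; simp [bitNot]
  · simp [bitNot, hj]

/-- The squared Hellinger distances between the transcripts on planted bits `00`, `10`, and on
planted bits `00`, `01`. -/
noncomputable def transcriptGap (F G : L → (ι → Bool) → ℝ) (D : ι → Bool) (i : ι) : ℝ :=
  ∑ l, (plantedMean (G l) (bitNot D) i false * sqrtGap (F l) D i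
    + plantedMean (F l) D i false * sqrtGap (G l) (bitNot D) i)

variable {F G : L → (ι → Bool) → ℝ}

theorem sum_expect_mul_expect (h : ∀ x y, ∑ l, F l x * G l y = 1)
    (u v : (ι → Bool) → ι → Bool) : ∑ l, (𝔼 U, F l (u U)) * (𝔼 W, G l (v W)) = 1 := by
  simp only [Finset.expect_mul_expect]
  rw [← Finset.expect_sum_comm]
  simp only [← Finset.expect_sum_comm, h]
  simp

/-- For a fixed mask the transcript `l` has probability `q l * r l`. The gaps of both players add up
to at most four times its entropy, since `negMulLog` of a product splits into exactly the two
weighted terms. Averaging over the mask then costs a factor `2`. -/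
theorem expect_sum_transcriptGap_le (hF0 : ∀ l x, 0 ≤ F l x) (hF1 : ∀ l x, F l x ≤ 1)
    (hG0 : ∀ l y, 0 ≤ G l y) (hG1 : ∀ l y, G l y ≤ 1) (h : ∀ x y, ∑ l, F l x * G l y = 1) :
    ∑ i, 𝔼 D, transcriptGap F G D i ≤ 8 * Real.log (Fintype.card L) := by
  set a : (ι → Bool) → ι → ℝ := fun D i =>
    ∑ l, plantedMean (G l) (bitNot D) i false * sqrtGap (F l) D i with ha
  set b : (ι → Bool) → ι → ℝ := fun D i =>
    ∑ l, plantedMean (F l) D i false * sqrtGap (G l) (bitNot D) i with hb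
  have hmask : ∀ D : ι → Bool, ∑ i, (if D i = true then a D i else b D i)
      ≤ 4 * Real.log (Fintype.card L) := by
    intro D
    set q : L → ℝ := fun l => 𝔼 U, F l (bitMask U D) with hq
    set r : L → ℝ := fun l => 𝔼 W, G l (bitMask W (bitNot D)) with hr
    have hq0 : ∀ l, 0 ≤ q l := fun l => Finset.expect_nonneg fun _ _ => hF0 _ _
    have hr0 : ∀ l, 0 ≤ r l := fun l => Finset.expect_nonneg fun _ _ => hG0 _ _
    -- A coordinate left to one player is `false` for the other, whose masked mean is thus already
    -- the planted mean at `false`.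
    have hi : ∀ i, (if D i = true then a D i else b D i)
        = ∑ l, (r l * (if D i = true then sqrtGap (F l) D i else 0)
          + q l * (if bitNot D i = true then sqrtGap (G l) (bitNot D) i else 0)) := by
      intro i
      cases hD : D i with
      | true =>
        have hD' : bitNot D i = false := by simp [bitNot, hD]
        simp only [hD', if_true, ha, hr, expect_bitMask_of_eq_false _ hD']
        simp
      | false =>
        have hD' : bitNot D i = true := by simp [bitNot, hD]
        simp only [hD', if_true, hb, hq, expect_bitMask_of_eq_false _ hD]
        simp
    calc ∑ i, (if D i = true then a D i else b D i)
        = ∑ l, (r l * ∑ i, (if D i = true then sqrtGap (F l) D i else 0)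
          + q l * ∑ i, (if bitNot D i = true then sqrtGap (G l) (bitNot D) i else 0)) := by
          rw [Finset.sum_congr rfl fun i _ => hi i, Finset.sum_comm]
          simp only [Finset.sum_add_distrib, Finset.mul_sum]
      _ ≤ ∑ l, 4 * negMulLog (q l * r l) := Finset.sum_le_sum fun l _ => by
          rw [negMulLog_mul]
          have h1 : r l * _ ≤ r l * (4 * negMulLog (q l)) :=
            mul_le_mul_of_nonneg_left (sum_sqrtGap_le (hF0 l) (hF1 l) D) (hr0 l)
          have h2 : q l * _ ≤ q l * (4 * negMulLog (r l)) :=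
            mul_le_mul_of_nonneg_left (sum_sqrtGap_le (hG0 l) (hG1 l) (bitNot D)) (hq0 l)
          linarith
      _ ≤ 4 * Real.log (Fintype.card L) := by
          rw [← Finset.mul_sum]
          refine mul_le_mul_of_nonneg_left (sum_negMulLog_le_log_card _
            (fun l => mul_nonneg (hq0 l) (hr0 l)) ?_) (by norm_num)
          exact sum_expect_mul_expect h _ _
  -- Neither `a` nor `b` at `i` depends on `D i`, and each is selected for half of the masks.
  have havg : ∀ i, 𝔼 D, transcriptGap F G D i
      = 2 * 𝔼 D : ι → Bool, (if D i = true then a D i else b D i) := by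
    intro i
    have h1 : ∀ D, transcriptGap F G D i = a D i + b D i := fun D => by
      simp only [transcriptGap, ha, hb, Finset.sum_add_distrib]
    have h2 : ∀ D c, a (Function.update D i c) i = a D i := fun D c => by
      simp only [ha, bitNot_update, plantedMean_update, sqrtGap_update]
    have h3 : ∀ D c, b (Function.update D i c) i = b D i := fun D c => by
      simp only [hb, bitNot_update, plantedMean_update, sqrtGap_update]
    rw [expect_cube_split i fun D : ι → Bool => if D i = true then a D i else b D i]
    simp only [h1, h2, h3, Function.update_self, Finset.expect_add_distrib]
    simp
    ring
  simp only [havg]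
  rw [← Finset.mul_sum, ← Finset.expect_sum_comm]
  have h2 : 𝔼 D : ι → Bool, ∑ i, (if D i = true then a D i else b D i)
      ≤ 𝔼 _D : ι → Bool, 4 * Real.log (Fintype.card L) :=
    Finset.expect_le_expect fun D _ => hmask D
  rw [Fintype.expect_const] at h2
  linarith

/-- Events of which at most one occurs are rarely hit on disjoint planted inputs. -/
theorem sum_expect_planted_disjoint_le (hF0 : ∀ l x, 0 ≤ F l x) (hG0 : ∀ l y, 0 ≤ G l y)
    (h : ∀ x y, ∑ l, F l x * G l y = 1) (e : L → (ι → Bool) → ι → ℝ) (he0 : ∀ l x i, 0 ≤ e l x i)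
    (he1 : ∀ l x, ∑ i, e l x i ≤ 1) :
    ∑ i, 𝔼 D, ∑ l, plantedMean (fun x => F l x * e l x i) D i true
      * plantedMean (G l) (bitNot D) i false ≤ 4 := by
  set k : ι → (ι → Bool) → ℝ := fun i D =>
    ∑ l, (𝔼 U, F l (bitMask U D) * e l (bitMask U D) i) * 𝔼 W, G l (bitMask W (bitNot D)) with hk
  have hK0 : ∀ l i x, 0 ≤ F l x * e l x i := fun l i x => mul_nonneg (hF0 _ _) (he0 _ _ _)
  have hk0 : ∀ i D, 0 ≤ k i D := fun i D => Finset.sum_nonneg fun l _ =>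
    mul_nonneg (Finset.expect_nonneg fun _ _ => hK0 _ _ _)
      (Finset.expect_nonneg fun _ _ => hG0 _ _)
  -- The planted pair `10` arises from the masked law when `D i` and the bit of `U` at `i` are both
  -- `true`, each with probability `1 / 2`; hence the factor `4`.
  have h1 : ∀ i, 𝔼 D, ∑ l, plantedMean (fun x => F l x * e l x i) D i true
      * plantedMean (G l) (bitNot D) i false ≤ 4 * 𝔼 D, k i D := by
    intro i
    rw [expect_cube_split i (k i)]
    have h2 : 0 ≤ 𝔼 D, k i (Function.update D i false) := Finset.expect_nonneg fun _ _ => hk0 _ _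
    have h3 : 𝔼 D, ∑ l, plantedMean (fun x => F l x * e l x i) D i true
        * plantedMean (G l) (bitNot D) i false ≤ 𝔼 D, 2 * k i (Function.update D i true) := by
      refine Finset.expect_le_expect fun D _ => ?_
      simp only [hk]
      rw [Finset.mul_sum]
      refine Finset.sum_le_sum fun l _ => ?_
      have hD : Function.update D i true i = true := Function.update_self _ _ _
      have hD' : bitNot (Function.update D i true) i = false := by simp [bitNot]
      rw [expect_bitMask_of_eq_true (fun x => F l x * e l x i) hD,
        expect_bitMask_of_eq_false _ hD', bitNot_update]
      simp only [plantedMean_update]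
      have h4 := mul_nonneg (plantedMean_nonneg (hK0 l i) D i false)
        (plantedMean_nonneg (hG0 l) (bitNot D) i false)
      linarith
    rw [← Finset.mul_expect] at h3
    linarith
  calc _ ≤ ∑ i, 4 * 𝔼 D, k i D := Finset.sum_le_sum fun i _ => h1 i
    _ = 4 * 𝔼 D, ∑ i, k i D := by rw [← Finset.mul_sum, ← Finset.expect_sum_comm]
    _ ≤ 4 * 𝔼 _D : ι → Bool, (1 : ℝ) := by
        refine mul_le_mul_of_nonneg_left (Finset.expect_le_expect fun D _ => ?_) (by norm_num)
        rw [← sum_expect_mul_expect h (fun U => bitMask U D) fun W => bitMask W (bitNot D)]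
        simp only [hk]
        rw [Finset.sum_comm]
        refine Finset.sum_le_sum fun l _ => ?_
        rw [← Finset.sum_mul]
        refine mul_le_mul_of_nonneg_right ?_ (Finset.expect_nonneg fun _ _ => hG0 _ _)
        rw [← Finset.expect_sum_comm]
        refine Finset.expect_le_expect fun U _ => ?_
        rw [← Finset.mul_sum]
        exact mul_le_of_le_one_right (hF0 _ _) (he1 _ _)
    _ = 4 := by simp

/-- Finding the unique common element of two sets requires many rectangles: if the transcript and
the first input determine the planted common element with probability `2 / 3`, then the number of
transcripts is exponential in the size of the ground set. -/
theorem card_le_of_find_planted (hF0 : ∀ l x, 0 ≤ F l x) (hF1 : ∀ l x, F l x ≤ 1)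
    (hG0 : ∀ l y, 0 ≤ G l y) (hG1 : ∀ l y, G l y ≤ 1) (h : ∀ x y, ∑ l, F l x * G l y = 1)
    (e : L → (ι → Bool) → ι → ℝ) (he0 : ∀ l x i, 0 ≤ e l x i) (he1 : ∀ l x, ∑ i, e l x i ≤ 1)
    (hfind : 2 / 3 * (Fintype.card ι : ℝ)
      ≤ ∑ i, 𝔼 D, ∑ l, plantedMean (fun x => F l x * e l x i) D i true
        * plantedMean (G l) (bitNot D) i true) :
    (Fintype.card ι : ℝ) ≤ 8 + 576 * Real.log (Fintype.card L) := by
  have hei : ∀ l x i, e l x i ≤ 1 := fun l x i =>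
    (Finset.single_le_sum (fun j _ => he0 l x j) (Finset.mem_univ i)).trans (he1 l x)
  have hstep : ∀ D i, ∑ l, plantedMean (fun x => F l x * e l x i) D i true
        * plantedMean (G l) (bitNot D) i true
      ≤ ∑ l, plantedMean (fun x => F l x * e l x i) D i true
        * plantedMean (G l) (bitNot D) i false + (1 / 6 + 36 * transcriptGap F G D i) := by
    intro D i
    have hc := sum_mul_abs_sub_le_of_sum_mul_eq_one (fun l a => plantedMean (F l) D i a)
      (fun l b => plantedMean (G l) (bitNot D) i b)
      (fun l a => plantedMean_nonneg (hF0 l) _ _ _) (fun l b => plantedMean_nonneg (hG0 l) _ _ _)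
      (fun a b => sum_expect_mul_expect h _ _)
    refine le_trans ?_ (add_le_add_right hc _)
    rw [← Finset.sum_add_distrib]
    refine Finset.sum_le_sum fun l _ => ?_
    have h1 : plantedMean (fun x => F l x * e l x i) D i true ≤ plantedMean (F l) D i true :=
      Finset.expect_le_expect fun U _ => mul_le_of_le_one_right (hF0 _ _) (hei _ _ _)
    have h0 : 0 ≤ plantedMean (fun x => F l x * e l x i) D i true :=
      plantedMean_nonneg (fun x => mul_nonneg (hF0 _ _) (he0 _ _ _)) _ _ _
    have h2 := le_abs_self
      (plantedMean (G l) (bitNot D) i true - plantedMean (G l) (bitNot D) i false)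
    have h3 := abs_nonneg
      (plantedMean (G l) (bitNot D) i true - plantedMean (G l) (bitNot D) i false)
    nlinarith [mul_le_mul_of_nonneg_left h2 h0, mul_le_mul_of_nonneg_right h1 h3]
  have hsum := hfind.trans (Finset.sum_le_sum fun i _ =>
    Finset.expect_le_expect fun D _ => hstep D i)
  simp only [Finset.expect_add_distrib, Finset.sum_add_distrib, ← Finset.mul_expect,
    Fintype.expect_const, ← Finset.mul_sum, Finset.sum_const, Finset.card_univ, nsmul_eq_mul]
    at hsum
  have h1 := sum_expect_planted_disjoint_le hF0 hG0 h e he0 he1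
  have h2 := expect_sum_transcriptGap_le hF0 hF1 hG0 hG1 h
  -- With `m` coordinates: `2 m / 3 ≤ 4 + m / 6 + 36 * 8 * log |L|`.
  linarith

end Rectangles

/-! ### Heavy actions in approximate equilibria -/

section Heavy

variable {U V : Type*} [Fintype U] [Fintype V]

theorem expectedPayoff_swap (w : U → V → Bool) (a : stdSimplex ℝ U) (b : stdSimplex ℝ V) :
    expectedPayoff w a b = expectedPayoff (fun v u => w u v) b a := by
  unfold expectedPayoff
  rw [Finset.sum_comm]
  exact Finset.sum_congr rfl fun v _ => Finset.sum_congr rfl fun u _ => by ring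

/-- If a player is paid for guessing the successor of the action of the opponent, then in an
approximate equilibrium each heavy action is the successor of a heavy action. -/
theorem exists_heavy_of_best_response [DecidableEq U] {w : U → V → Bool} {f : V → U}
    (hw : ∀ u v, w u v = true ↔ f v = u)
    (hfib : ∀ u, (Finset.univ.filter fun v => f v = u).card ≤ 3)
    {a : stdSimplex ℝ U} {b : stdSimplex ℝ V} {N ε : ℝ} (hN : N = Fintype.card U)
    (hε : ε ≤ 1 / (16 * N ^ 2))
    (h : ∀ a' : stdSimplex ℝ U, expectedPayoff w a' b - expectedPayoff w a b ≤ ε)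
    {u : U} (hu : 1 / (4 * N) < a.1 u) : ∃ v, f v = u ∧ 1 / (4 * N) < b.1 v := by
  have hN0 : 0 < N := by rw [hN]; exact_mod_cast Fintype.card_pos_iff.2 ⟨u⟩
  set β : U → ℝ := fun u => ∑ v with f v = u, b.1 v with hβ
  have hpay : ∀ a' : stdSimplex ℝ U, expectedPayoff w a' b = ∑ u, a'.1 u * β u := by
    intro a'
    unfold expectedPayoff
    refine Finset.sum_congr rfl fun u _ => ?_
    rw [hβ, Finset.mul_sum, Finset.sum_filter]
    refine Finset.sum_congr rfl fun v _ => ?_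
    simp only [hw]
    split_ifs <;> simp
  obtain ⟨m, -, hm⟩ := Finset.exists_max_image Finset.univ β ⟨u, Finset.mem_univ u⟩
  have hβsum : ∑ u, β u = 1 := by
    rw [hβ, Finset.sum_fiberwise]; exact b.2.2
  have hmN : 1 / N ≤ β m := by
    have h1 : ∑ u, β u ≤ ∑ _u : U, β m := Finset.sum_le_sum fun u _ => hm u (Finset.mem_univ u)
    rw [hβsum, Finset.sum_const, Finset.card_univ, nsmul_eq_mul, ← hN] at h1
    rw [div_le_iff₀ hN0]; linarith
  -- Deviation to the pure best response `m`. All summands are nonnegative, so the bound holds for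
  -- each one alone.
  have hreg : ∑ u', a.1 u' * (β m - β u') ≤ ε := by
    have h1 := h ⟨Pi.single m 1, single_mem_stdSimplex ℝ m⟩
    rw [hpay, hpay] at h1
    simp only [Pi.single_apply, ite_mul, one_mul, zero_mul, Finset.sum_ite_eq',
      Finset.mem_univ, if_true] at h1
    simp only [mul_sub, Finset.sum_sub_distrib]
    rw [← Finset.sum_mul, a.2.2, one_mul]
    exact h1
  have hone : a.1 u * (β m - β u) ≤ ε := le_trans
    (Finset.single_le_sum (f := fun u' => a.1 u' * (β m - β u')) (fun u' _ =>
      mul_nonneg (a.2.1 u') (sub_nonneg.2 (hm u' (Finset.mem_univ u')))) (Finset.mem_univ u)) hreg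
  have hlt : β m - β u < 1 / (4 * N) := by
    by_contra hc
    push Not at hc
    have h0 : 0 < 1 / (4 * N) := by positivity
    have h1 : 1 / (4 * N) * (1 / (4 * N)) < a.1 u * (β m - β u) := by nlinarith
    have h2 : 1 / (4 * N) * (1 / (4 * N)) = 1 / (16 * N ^ 2) := by field_simp; norm_num
    linarith
  by_contra hc
  push Not at hc
  -- By `hlt` the payoff `β u` exceeds `1 / N - 1 / (4 N) = 3 / (4 N)`, too much for three light
  -- predecessors.
  have h1 : β u ≤ 3 * (1 / (4 * N)) := by
    calc β u ≤ ∑ v with f v = u, 1 / (4 * N) :=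
          Finset.sum_le_sum fun v hv => hc v (Finset.mem_filter.1 hv).2
      _ ≤ 3 * (1 / (4 * N)) := by
          rw [Finset.sum_const, nsmul_eq_mul]
          exact mul_le_mul_of_nonneg_right (by exact_mod_cast hfib u) (by positivity)
  have h2 : 1 / N = 4 * (1 / (4 * N)) := by field_simp
  linarith

theorem exists_heavy (a : stdSimplex ℝ U) {N : ℝ} (hN : N = Fintype.card U) :
    ∃ u, 1 / (4 * N) < a.1 u := by
  have hne : Nonempty U := by
    by_contra hc
    rw [not_nonempty_iff] at hc
    simpa using a.2.2
  have hN0 : 0 < N := by rw [hN]; exact_mod_cast Fintype.card_pos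
  by_contra hc
  push Not at hc
  have h1 : ∑ u, a.1 u ≤ ∑ _u : U, 1 / (4 * N) := Finset.sum_le_sum fun u _ => hc u
  rw [a.2.2, Finset.sum_const, Finset.card_univ, nsmul_eq_mul, ← hN] at h1
  have h2 : N * (1 / (4 * N)) = 1 / 4 := by field_simp
  rw [h2] at h1
  norm_num at h1

end Heavy

/-! ### Dynamics of the two successor maps -/

namespace TwoCycle

variable {n : ℕ}

/-- The successor of a vertex in the graph of player `A`. -/
def succA (x : ZMod n → Bool) : Vertex n → Vertex n
  | (i, .s1) => (i + 1, if x (i + 1) = false then .s0 else .s11)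
  | (i, .s0) => if x i = false then (i + 1, if x (i + 1) = false then .s0 else .s01)
      else (i - 1, bitLabel (x (i - 1)))
  | (i, .s01) => (i, .s1)
  | (i, .s11) => (i, .s1)

/-- The successor of a vertex in the graph of player `B`. -/
def succB (y : ZMod n → Bool) : Vertex n → Vertex n
  | (i, .s1) => (i + 1, if y (i + 1) = false then .s0 else .s11)
  | (i, .s0) => (i + 1, if y (i + 1) = false then .s0 else .s01)
  | (i, .s01) => (i, .s1)
  | (i, .s11) => (i, .s1)

open Classical in
theorem utilityA_eq_true_iff (x : ZMod n → Bool) (u v : Vertex n) :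
    utilityA x u v = true ↔ succA x v = u := by
  obtain ⟨i, l⟩ := v
  rw [utilityA, decide_eq_true_iff, eq_comm (a := succA x _)]
  simp only [edgesA, Set.mem_union, Set.mem_ofPred_eq, Prod.mk.injEq]
  cases l <;> cases hx : x i <;> simp [succA, hx]

open Classical in
theorem utilityB_eq_true_iff (y : ZMod n → Bool) (u v : Vertex n) :
    utilityB y u v = true ↔ succB y u = v := by
  obtain ⟨i, l⟩ := u
  rw [utilityB, decide_eq_true_iff, eq_comm (a := succB y _)]
  simp only [edgesB, Set.mem_union, Set.mem_ofPred_eq, Prod.mk.injEq]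
  cases l <;> simp [succB]

/-- The vertices that can have `u` as a successor in one of the graphs. -/
def candidates : Vertex n → Finset (Vertex n)
  | (i, .s1) => {(i, .s01), (i, .s11), (i + 1, .s0)}
  | (i, _) => {(i - 1, .s1), (i - 1, .s0), (i + 1, .s0)}

theorem card_candidates_le (u : Vertex n) : (candidates u).card ≤ 3 := by
  obtain ⟨i, l⟩ := u
  cases l <;> exact Finset.card_le_three

theorem mem_candidates_succA (x : ZMod n → Bool) (v : Vertex n) :
    v ∈ candidates (succA x v) := by
  obtain ⟨i, l⟩ := v
  cases l <;> cases h : x i <;> cases h' : x (i + 1) <;> cases h'' : x (i - 1) <;>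
    simp [succA, candidates, bitLabel, h, h', h'']

theorem mem_candidates_succB (y : ZMod n → Bool) (v : Vertex n) :
    v ∈ candidates (succB y v) := by
  obtain ⟨i, l⟩ := v
  cases l <;> cases h' : y (i + 1) <;> simp [succB, candidates, h']

theorem card_fiber_le [NeZero n] {f : Vertex n → Vertex n} (hf : ∀ v, v ∈ candidates (f v))
    (u : Vertex n) : (Finset.univ.filter fun v => f v = u).card ≤ 3 := by
  refine (Finset.card_le_card fun v hv => ?_).trans (card_candidates_le u)
  rw [← (Finset.mem_filter.1 hv).2]
  exact hf v

/-- A mixed strategy is supported, up to small weights, on actions at position `i - 1`. -/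
def Reveals [NeZero n] (a : stdSimplex ℝ (Vertex n)) (i : ZMod n) : Prop :=
  ∀ u, 1 / (4 * ((4 * n : ℕ) : ℝ)) < a.1 u → u.1 = i - 1

theorem Reveals.unique [NeZero n] {a : stdSimplex ℝ (Vertex n)} {i j : ZMod n} (hi : Reveals a i)
    (hj : Reveals a j) : i = j := by
  obtain ⟨u, hu⟩ := exists_heavy a (N := ((4 * n : ℕ) : ℝ)) (by rw [card_vertex])
  have := (hi u hu).symm.trans (hj u hu)
  simpa using this

/-- In an approximate equilibrium the heavy actions of player `A` are closed under some inverse of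
the composition of the two successor maps. -/
theorem exists_heavy_of_isApproxNash [NeZero n] {x y : ZMod n → Bool} {ε : ℝ}
    (hε : ε ≤ 1 / (16 * ((4 * n : ℕ) : ℝ) ^ 2)) {a b : stdSimplex ℝ (Vertex n)}
    (h : IsApproxNash ε (utilityA x) (utilityB y) a b) {u : Vertex n}
    (hu : 1 / (4 * ((4 * n : ℕ) : ℝ)) < a.1 u) :
    ∃ u', succA x (succB y u') = u ∧ 1 / (4 * ((4 * n : ℕ) : ℝ)) < a.1 u' := by
  have hN : ((4 * n : ℕ) : ℝ) = Fintype.card (Vertex n) := by rw [card_vertex]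
  obtain ⟨v, rfl, hv⟩ := exists_heavy_of_best_response (utilityA_eq_true_iff x)
    (card_fiber_le (mem_candidates_succA x)) hN hε h.1 hu
  obtain ⟨u', rfl, hu'⟩ := exists_heavy_of_best_response
    (w := fun v u => utilityB y u v) (fun v u => utilityB_eq_true_iff y u v)
    (card_fiber_le (mem_candidates_succB y)) hN hε
    (fun b' => by simpa only [expectedPayoff_swap (utilityB y)] using h.2 b') hv
  exact ⟨u', rfl, hu'⟩

/-- A point of `p` with maximal `φ` is the image of a point of `p`, whose `φ` would be larger unless
the maximum is `0`. -/
theorem eq_zero_of_descending {V : Type*} [Finite V] {p : V → Prop} {g : V → V} {φ : V → ℕ}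
    (hp : ∀ u, p u → ∃ u', g u' = u ∧ p u') (hφ : ∀ u, p u → φ (g u) < φ u ∨ φ (g u) = 0)
    {u : V} (hu : p u) : φ u = 0 := by
  obtain ⟨m, hm, hmax⟩ := Set.exists_max_image {u | p u} φ (Set.toFinite _) ⟨u, hu⟩
  obtain ⟨m', rfl, hm'⟩ := hp m hm
  have h1 := hmax m' hm'
  have h2 := hmax u hu
  rcases hφ m' hm' with h | h <;> omega

theorem eq_true_of_succA_snd {x : ZMod n → Bool} {v : Vertex n} {j : ZMod n} {l : Label}
    (h : succA x v = (j, l)) (hl : l = .s01 ∨ l = .s11) : x j = true := by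
  obtain ⟨i, l'⟩ := v
  rcases hl with rfl | rfl <;> cases l' <;> simp only [succA, bitLabel] at h <;>
    (try split_ifs at h) <;> simp_all

theorem val_sub_one_lt [Fact (1 < n)] {d : ZMod n} (hd : d ≠ 0) : (d - 1).val < d.val := by
  have h1 : 0 < d.val := Nat.pos_of_ne_zero fun h => hd ((ZMod.val_eq_zero d).1 h)
  rw [ZMod.val_sub (by rw [ZMod.val_one]; exact h1), ZMod.val_one]
  omega

/-- If the special index is preceded by an index where `x` is `0` and `y` is `1`, then each
approximate equilibrium reveals the special index to player `A`. -/
theorem reveals_of_isApproxNash [NeZero n] [Fact (1 < n)] {x y : ZMod n → Bool} {ε : ℝ}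
    (hε : ε ≤ 1 / (16 * ((4 * n : ℕ) : ℝ) ^ 2)) {a b : stdSimplex ℝ (Vertex n)}
    (h : IsApproxNash ε (utilityA x) (utilityB y) a b) {i : ZMod n} (hxi : x i = true)
    (hyi : y i = false) (huniq : ∀ j, x j = true → y j = false → j = i)
    (hx : x (i - 1) = false) (hy : y (i - 1) = true) : Reveals a i := by
  intro u hu
  -- The potential is the number of forward steps left to position `i - 1`. The map must never step
  -- past that position.
  have hz := eq_zero_of_descending (φ := fun u : Vertex n => (i - 1 - u.1).val)
    (fun u hu => exists_heavy_of_isApproxNash hε h hu) ?_ hu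
  · rw [ZMod.val_eq_zero, sub_eq_zero] at hz
    exact hz.symm
  rintro ⟨j, l⟩ hj
  obtain ⟨u', hu', -⟩ := exists_heavy_of_isApproxNash hε h hj
  have h1 : i - 1 - j ≠ 0 → (i - 1 - (j + 1)).val < (i - 1 - j).val := fun hd => by
    have := val_sub_one_lt hd
    rwa [sub_sub] at this
  have h2 : i - 1 - j ≠ 0 → i - 1 - (j + 1) ≠ 0 →
      (i - 1 - (j + 1 + 1)).val < (i - 1 - j).val := fun hd hd' => by
    have := val_sub_one_lt hd'
    rw [sub_sub] at this
    exact this.trans (h1 hd)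
  have hne : j + 1 ≠ i → i - 1 - j ≠ 0 := fun hd h0 => hd (by linear_combination -h0)
  -- At `i - 1` the labels `01` and `11` would escape forward. A heavy action is a value of `succA
  -- x`, and these labels then force `x = 1` there.
  have hlab : l = .s01 ∨ l = .s11 → j + 1 ≠ i := by
    rintro hl rfl
    rw [add_sub_cancel_right, eq_true_of_succA_snd hu' hl] at hx
    exact absurd hx (by simp)
  have hadv : l = .s0 ∨ l = .s1 → (succB y (j, l) = (j + 1, .s0) ∧ y (j + 1) = false) ∨
      ((succB y (j, l) = (j + 1, .s01) ∨ succB y (j, l) = (j + 1, .s11)) ∧ y (j + 1) = true) := by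
    rintro (rfl | rfl) <;> cases hy1 : y (j + 1) <;> simp [succB, hy1]
  have hmain : l = .s0 ∨ l = .s1 → (i - 1 - (succA x (succB y (j, l))).1).val < (i - 1 - j).val ∨
      (i - 1 - (succA x (succB y (j, l))).1).val = 0 := by
    intro hl
    rcases hadv hl with ⟨e, hy1⟩ | ⟨e, hy1⟩
    · rw [e]
      cases hx1 : x (j + 1) with
      | true =>
        -- The trap: from position `i - 1`, `B` moves to `(i, 0)` and the back edge of `A` returns
        -- to `i - 1`.
        have hj1 := huniq _ hx1 hy1
        right
        simp [succA, ← hj1, hx1]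
      | false =>
        left
        have hd : j + 1 ≠ i := fun hd => by simp [hd, hxi] at hx1
        -- A double step cannot jump over `i - 1`, because `y (i - 1) = 1` stops it there.
        have hd' : i - 1 - (j + 1) ≠ 0 := fun h0 => by
          rw [← sub_eq_zero.1 h0, hy] at hy1
          exact absurd hy1 (by simp)
        simpa [succA, hx1] using h2 (hne hd) hd'
    · left
      have hd : j + 1 ≠ i := fun hd => by simp [hd, hyi] at hy1
      rcases e with e | e <;> rw [e] <;> exact h1 (hne hd)
  cases l with
  | s0 => exact hmain (.inl rfl)
  | s1 => exact hmain (.inr rfl)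
  | s01 => exact .inl (h1 (hne (hlab (.inl rfl))))
  | s11 => exact .inl (h1 (hne (hlab (.inr rfl))))

/-- An instance with `n = 3` in which the special index is preceded by an index where both strings
are `1`. -/
theorem reveals_of_isApproxNash_three {x y : ZMod 3 → Bool} {ε : ℝ}
    (hε : ε ≤ 1 / (16 * ((4 * 3 : ℕ) : ℝ) ^ 2)) {a b : stdSimplex ℝ (Vertex 3)}
    (h : IsApproxNash ε (utilityA x) (utilityB y) a b) {i : ZMod 3}
    (hit : ∀ u : Vertex 3, ((fun u => succA x (succB y u))^[12] u).1 = i - 1) : Reveals a i := by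
  have key : ∀ (k : ℕ) (u : Vertex 3), 1 / (4 * ((4 * 3 : ℕ) : ℝ)) < a.1 u →
      ∃ u', (fun u => succA x (succB y u))^[k] u' = u ∧ 1 / (4 * ((4 * 3 : ℕ) : ℝ)) < a.1 u' := by
    intro k
    induction k with
    | zero => exact fun u hu => ⟨u, rfl, hu⟩
    | succ k ih =>
      intro u hu
      obtain ⟨u₁, rfl, hu₁⟩ := ih u hu
      obtain ⟨u₂, rfl, hu₂⟩ := exists_heavy_of_isApproxNash hε h hu₁
      exact ⟨u₂, rfl, hu₂⟩
  intro u hu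
  obtain ⟨u', rfl, -⟩ := key 12 u hu
  exact hit u'

end TwoCycle

/-! ### Reduction from the intersection problem -/

namespace TwoCycle

variable {n : ℕ}

/-- There are two games that look the same to player `A` but have different special indices. -/
theorem exists_indistinguishable_games (n : ℕ) [NeZero n] (hn : 3 ≤ n) {ε : ℝ}
    (hε : ε ≤ 1 / (16 * ((4 * n : ℕ) : ℝ) ^ 2)) :
    ∃ (x : ZMod n → Bool) (y : Bool → ZMod n → Bool) (i : Bool → ZMod n), i true ≠ i false ∧
      ∀ c, IsGame (utilityA x) (utilityB (y c)) ∧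
        ∀ a b, IsApproxNash ε (utilityA x) (utilityB (y c)) a b → Reveals a (i c) := by
  have hgame : ∀ (x : ZMod n → Bool) (i : ZMod n), x i = true →
      IsGame (utilityA x) (utilityB fun j => decide (j ≠ i)) := fun x i hi =>
    ⟨x, _, ⟨i, by simp [hi], fun j hj => by simpa using hj.2⟩, rfl, rfl⟩
  rcases hn.eq_or_lt with rfl | hn
  -- Two special indices whose predecessors have `x = 0` occupy four positions. For `n = 3` one
  -- predecessor must have `x = 1`, and iterating the map `12` times is checked directly.
  · refine ⟨fun j => decide (j ≠ 0), fun c j => decide (j ≠ if c then 2 else 1),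
      fun c => if c then 2 else 1, by decide, fun c => ⟨hgame _ _ ?_, fun a b h => ?_⟩⟩
    · revert c; decide
    · refine reveals_of_isApproxNash_three hε h ?_
      clear h
      revert c
      decide
  · have : Fact (1 < n) := ⟨by omega⟩
    have hcast : ∀ k : ℕ, 0 < k → k < 4 → ((k : ℕ) : ZMod n) ≠ 0 := fun k h0 hk h => by
      have := Nat.le_of_dvd h0 ((ZMod.natCast_eq_zero_iff k n).1 h)
      omega
    have h1 : (1 : ZMod n) ≠ 0 := by simpa only [Nat.cast_one] using hcast 1 (by norm_num) (by norm_num)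
    have h2 : (2 : ZMod n) ≠ 0 := by simpa using hcast 2 (by norm_num) (by norm_num)
    have h3 : (3 : ZMod n) ≠ 0 := by simpa using hcast 3 (by norm_num) (by norm_num)
    refine ⟨fun j => decide (j = 1 ∨ j = 3), fun c j => decide (j ≠ if c then 3 else 1),
      fun c => if c then 3 else 1, fun h => h2 ?_, fun c => ⟨hgame _ _ ?_, fun a b h => ?_⟩⟩
    · simp only [if_true, Bool.false_eq_true, if_false] at h
      linear_combination h
    · cases c <;> simp
    · refine reveals_of_isApproxNash hε h ?_ (by simp) (fun j _ hj => by simpa using hj) ?_ ?_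
      · cases c <;> simp
      · cases c
        · simp [h1.symm, h3.symm]
        · simp only [if_true, decide_eq_false_iff_not, not_or]
          exact ⟨fun h => h1 (by linear_combination h), fun h => h1 (by linear_combination -h)⟩
      · simp [h1]

/-- The position in `ZMod n` of coordinate `k` of an instance of the intersection problem. -/
def position (n : ℕ) (k : Fin (n / 2)) : ZMod n := ((2 * (k : ℕ) + 1 : ℕ) : ZMod n)

theorem natCast_inj_of_lt {a b : ℕ} (ha : a < n) (hb : b < n) (h : (a : ZMod n) = b) : a = b := by
  rw [ZMod.natCast_eq_natCast_iff'] at h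
  rwa [Nat.mod_eq_of_lt ha, Nat.mod_eq_of_lt hb] at h

theorem position_injective (n : ℕ) : Function.Injective (position n) := by
  intro k k' h
  have := natCast_inj_of_lt (by omega) (by omega) h
  exact Fin.ext (by omega)

/-- Coordinates sit at odd positions `2 k + 1 < n`, so their predecessors `2 k` carry none. There
`x` is `0` and `y` is `1`, as `reveals_of_isApproxNash` requires. -/
theorem position_ne_position_sub_one (k k' : Fin (n / 2)) : position n k' ≠ position n k - 1 := by
  intro h
  have h1 : position n k - 1 = ((2 * (k : ℕ) : ℕ) : ZMod n) := by
    simp [position]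
  rw [h1] at h
  have := natCast_inj_of_lt (by omega) (by omega) h
  omega

/-- The string of player `A` for a set of coordinates. -/
def stringA (n : ℕ) (X : Fin (n / 2) → Bool) : ZMod n → Bool := fun j =>
  decide (∃ k, position n k = j ∧ X k = true)

/-- The string of player `B` for a set of coordinates. -/
def stringB (n : ℕ) (Y : Fin (n / 2) → Bool) : ZMod n → Bool := fun j =>
  !decide (∃ k, position n k = j ∧ Y k = true)

section Planted

variable {X Y : Fin (n / 2) → Bool} {k : Fin (n / 2)}

theorem stringA_position : stringA n X (position n k) = X k := by
  simp [stringA, (position_injective n).eq_iff]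

theorem stringB_position : stringB n Y (position n k) = !Y k := by
  simp [stringB, (position_injective n).eq_iff]

theorem eq_position_of_special (hu : ∀ j, X j = true → Y j = true → j = k) {j : ZMod n}
    (hA : stringA n X j = true) (hB : stringB n Y j = false) : j = position n k := by
  simp only [stringA, decide_eq_true_eq] at hA
  obtain ⟨l, rfl, hl⟩ := hA
  rw [stringB_position] at hB
  rw [hu l hl (by simpa using hB)]

theorem isGame_strings (hX : X k = true) (hY : Y k = true)
    (hu : ∀ j, X j = true → Y j = true → j = k) :
    IsGame (utilityA (stringA n X)) (utilityB (stringB n Y)) :=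
  ⟨_, _, ⟨position n k, by simp [stringA_position, stringB_position, hX, hY],
    fun _ hj => eq_position_of_special hu hj.1 hj.2⟩, rfl, rfl⟩

theorem reveals_position [NeZero n] [Fact (1 < n)] {ε : ℝ}
    (hε : ε ≤ 1 / (16 * ((4 * n : ℕ) : ℝ) ^ 2)) (hX : X k = true) (hY : Y k = true)
    (hu : ∀ j, X j = true → Y j = true → j = k) {a b : stdSimplex ℝ (Vertex n)}
    (h : IsApproxNash ε (utilityA (stringA n X)) (utilityB (stringB n Y)) a b) :
    Reveals a (position n k) := by
  refine reveals_of_isApproxNash hε h (by rw [stringA_position, hX])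
    (by rw [stringB_position, hY]; rfl) (fun j hA hB => eq_position_of_special hu hA hB) ?_ ?_
  · simp [stringA, position_ne_position_sub_one]
  · simp [stringB, position_ne_position_sub_one]

end Planted

variable [NeZero n] {ε : ℝ}
  {P : RandomizedProtocol.{w} (Vertex n → Vertex n → Bool) (Vertex n → Vertex n → Bool)
    (stdSimplex ℝ (Vertex n)) (stdSimplex ℝ (Vertex n))}

/-- Without communication no equilibrium is found. -/
theorem one_le_of_bits_le (hn : 3 ≤ n) (hε : ε ≤ 1 / (16 * ((4 * n : ℕ) : ℝ) ^ 2))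
    (hP : P.SolvesWithError IsGame (fun uA uB a b => IsApproxNash ε uA uB a b) (1 / 3)) {C : ℕ}
    (hC : ∀ uA uB, IsGame uA uB → ∀ r, P.bits uA uB r ≤ C) : 1 ≤ C := by
  classical
  by_contra h0
  obtain ⟨x, y, i, hi, hxy⟩ := exists_indistinguishable_games n hn hε
  obtain ⟨r, hr⟩ := hP.exists_coins (fun _ : Bool => utilityA x) (fun c => utilityB (y c))
    fun c => (hxy c).1
  -- Over the two games the expected number of failures is at most `2 / 3 < 1`, so some coins
  -- succeed on both.
  have hlt : ((Fintype.card Bool : ℕ) : ℝ≥0∞) * (1 / 3) < 1 := by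
    rw [Fintype.card_bool, mul_one_div]
    exact (ENNReal.div_lt_iff (by simp) (by simp)).2 (by norm_num)
  have hz := hr.trans_lt hlt
  rw [Nat.cast_lt_one, Finset.card_eq_zero, Finset.filter_eq_empty_iff] at hz
  have hgood : ∀ c, Reveals (P.run (utilityA x) (utilityB (y c)) r).1 (i c) := fun c =>
    (hxy c).2 _ _ (not_not.1 (hz (Finset.mem_univ c)))
  have hbits : P.bits (utilityA x) (utilityB (y true)) r = 0 := by
    have := hC _ _ (hxy true).1 r
    omega
  have heq : (P.run (utilityA x) (utilityB (y true)) r).1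
      = (P.run (utilityA x) (utilityB (y false)) r).1 :=
    Protocol.run_fst_eq_of_bits_eq_zero _ hbits
  have ht := hgood true
  rw [heq] at ht
  exact hi (ht.unique (hgood false))

/-- The number of bits exchanged is linear in `n`. -/
theorem half_le_of_bits_le [Fact (1 < n)] (hε : ε ≤ 1 / (16 * ((4 * n : ℕ) : ℝ) ^ 2))
    (hP : P.SolvesWithError IsGame (fun uA uB a b => IsApproxNash ε uA uB a b) (1 / 3)) {C : ℕ}
    (hC : ∀ uA uB, IsGame uA uB → ∀ r, P.bits uA uB r ≤ C) :
    ((n / 2 : ℕ) : ℝ) ≤ 8 + 576 * C := by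
  classical
  set ι := Fin (n / 2) with hι
  -- A sample `ω` consists of the planted coordinate, the mask, and the raw bits of `A` and of `B`.
  -- The masks are complementary, so only the planted coordinate is common.
  let pX : ι × (ι → Bool) × (ι → Bool) × (ι → Bool) → ι → Bool := fun ω =>
    Function.update (bitMask ω.2.2.1 ω.2.1) ω.1 true
  let pY : ι × (ι → Bool) × (ι → Bool) × (ι → Bool) → ι → Bool := fun ω =>
    Function.update (bitMask ω.2.2.2 (bitNot ω.2.1)) ω.1 true
  have hpX : ∀ ω, pX ω ω.1 = true := fun ω => Function.update_self _ _ _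
  have hpY : ∀ ω, pY ω ω.1 = true := fun ω => Function.update_self _ _ _
  have hpu : ∀ ω j, pX ω j = true → pY ω j = true → j = ω.1 := by
    intro ω j h1 h2
    by_contra hj
    simp only [pX, pY, Function.update_of_ne hj, bitMask, bitNot, Bool.and_eq_true] at h1 h2
    simp [h1.2] at h2
  have hgame := fun ω => isGame_strings (hpX ω) (hpY ω) (hpu ω)
  obtain ⟨r, hr⟩ := hP.exists_coins (fun ω => utilityA (stringA n (pX ω)))
    (fun ω => utilityB (stringB n (pY ω))) hgame
  have hne : Nonempty (stdSimplex ℝ (Vertex n)) := ⟨⟨_, single_mem_stdSimplex ℝ (0, .s0)⟩⟩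
  obtain ⟨L, _, F, G, out, hcard, hpart, hout⟩ := (P.tree r.1).exists_rectangles C
  let inA : (ι → Bool) → (Vertex n → Vertex n → Bool) × P.PrivA := fun X =>
    (utilityA (stringA n X), r.2.1)
  let inB : (ι → Bool) → (Vertex n → Vertex n → Bool) × P.PrivB := fun Y =>
    (utilityB (stringB n Y), r.2.2)
  let f : L → (ι → Bool) → ℝ := fun l X => if F l (inA X) then 1 else 0
  let g : L → (ι → Bool) → ℝ := fun l Y => if G l (inB Y) then 1 else 0
  let e : L → (ι → Bool) → ι → ℝ := fun l X k =>
    if Reveals (out l (inA X)) (position n k) then 1 else 0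
  have hf0 : ∀ l X, 0 ≤ f l X := fun l X => by simp only [f]; split_ifs <;> norm_num
  have hf1 : ∀ l X, f l X ≤ 1 := fun l X => by simp only [f]; split_ifs <;> norm_num
  have hg0 : ∀ l Y, 0 ≤ g l Y := fun l X => by simp only [g]; split_ifs <;> norm_num
  have hg1 : ∀ l Y, g l Y ≤ 1 := fun l X => by simp only [g]; split_ifs <;> norm_num
  have he0 : ∀ l X k, 0 ≤ e l X k := fun l X k => by simp only [e]; split_ifs <;> norm_num
  have he1 : ∀ l X, ∑ k, e l X k ≤ 1 := by
    intro l X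
    simp only [e, Finset.sum_boole]
    have : (Finset.univ.filter fun k => Reveals (out l (inA X)) (position n k)).card ≤ 1 :=
      Finset.card_le_one.2 fun k hk k' hk' => position_injective n
        ((Finset.mem_filter.1 hk).2.unique (Finset.mem_filter.1 hk').2)
    exact_mod_cast this
  have hfg : ∀ X Y, ∑ l, f l X * g l Y = 1 := by
    intro X Y
    obtain ⟨l, hl, hu⟩ := hpart (inA X) (inB Y)
    rw [Finset.sum_eq_single l]
    · simp [f, g, hl]
    · intro l' _ hne'
      by_cases h1 : F l' (inA X) <;> by_cases h2 : G l' (inB Y) <;> simp [f, g, h1, h2]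
      exact hne' (hu l' ⟨h1, h2⟩)
    · simp
  set bad : ι × (ι → Bool) × (ι → Bool) × (ι → Bool) → Prop := fun ω =>
    ¬ IsApproxNash ε (utilityA (stringA n (pX ω))) (utilityB (stringB n (pY ω)))
      (P.run (utilityA (stringA n (pX ω))) (utilityB (stringB n (pY ω))) r).1
      (P.run (utilityA (stringA n (pX ω))) (utilityB (stringB n (pY ω))) r).2 with hbad
  -- On success, the rectangle containing the input pair has an output of `A` that reveals the
  -- planted position.
  have hpt : ∀ ω, 1 - (if bad ω then (1 : ℝ) else 0)
      ≤ ∑ l, (f l (pX ω) * e l (pX ω) ω.1) * g l (pY ω) := by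
    intro ω
    have hnn : ∀ l, 0 ≤ (f l (pX ω) * e l (pX ω) ω.1) * g l (pY ω) := fun l =>
      mul_nonneg (mul_nonneg (hf0 _ _) (he0 _ _ _)) (hg0 _ _)
    split_ifs with hω
    · simpa using Finset.sum_nonneg fun l _ => hnn l
    · obtain ⟨l, hl, -⟩ := hpart (inA (pX ω)) (inB (pY ω))
      have hR := reveals_position hε (hpX ω) (hpY ω) (hpu ω) (not_not.1 hω)
      have hrun : (P.run (utilityA (stringA n (pX ω))) (utilityB (stringB n (pY ω))) r).1
          = out l (inA (pX ω)) := hout _ _ l (hC _ _ (hgame ω) r) hl.1 hl.2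
      rw [hrun] at hR
      refine le_trans ?_ (Finset.single_le_sum (fun l _ => hnn l) (Finset.mem_univ l))
      simp [f, g, e, hl, hR]
  have hcount : ((Finset.univ.filter bad).card : ℝ) ≤ Fintype.card ι
      * Fintype.card (ι → Bool) ^ 3 / 3 := by
    have h1 := ENNReal.toReal_mono (by finiteness) hr
    rw [ENNReal.toReal_natCast, ENNReal.toReal_mul, ENNReal.toReal_natCast,
      ENNReal.toReal_div] at h1
    simp only [Fintype.card_prod, Nat.cast_mul] at h1
    refine le_trans (le_of_eq ?_) (h1.trans (le_of_eq ?_))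
    · rfl
    · norm_num; ring
  have hM : (0 : ℝ) < Fintype.card (ι → Bool) := by exact_mod_cast Fintype.card_pos
  have hfind : 2 / 3 * (Fintype.card ι : ℝ)
      ≤ ∑ i, 𝔼 D, ∑ l, plantedMean (fun x => f l x * e l x i) D i true
        * plantedMean (g l) (bitNot D) i true := by
    calc 2 / 3 * (Fintype.card ι : ℝ)
        ≤ ∑ i : ι, 𝔼 D, 𝔼 U, 𝔼 W, (1 - (if bad (i, D, U, W) then (1 : ℝ) else 0)) := by
          simp only [Finset.expect_sub_distrib, Finset.sum_sub_distrib, Fintype.expect_const]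
          have h2 : ∑ i : ι, 𝔼 D, 𝔼 U, 𝔼 W, (if bad (i, D, U, W) then (1 : ℝ) else 0)
              = (Finset.univ.filter bad).card / (Fintype.card (ι → Bool) : ℝ) ^ 3 := by
            rw [Finset.natCast_card_filter]
            simp only [Fintype.expect_eq_sum_div_card, Fintype.sum_prod_type,
              ← Finset.sum_div]
            field_simp
            rfl
          have h3 : ((Finset.univ.filter bad).card : ℝ) / (Fintype.card (ι → Bool) : ℝ) ^ 3
              ≤ Fintype.card ι / 3 := by
            rw [div_le_iff₀ (by positivity)]
            linarith
          rw [h2, Finset.sum_const, Finset.card_univ, nsmul_eq_mul, mul_one]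
          linarith
      _ ≤ ∑ i : ι, 𝔼 D, 𝔼 U, 𝔼 W, ∑ l, (f l (pX (i, D, U, W)) * e l (pX (i, D, U, W)) i)
            * g l (pY (i, D, U, W)) :=
          Finset.sum_le_sum fun i _ => Finset.expect_le_expect fun D _ =>
            Finset.expect_le_expect fun U _ => Finset.expect_le_expect fun W _ => hpt _
      _ = _ := by
          refine Finset.sum_congr rfl fun i _ => Finset.expect_congr rfl fun D _ => ?_
          simp only [plantedMean, Finset.expect_mul_expect, Finset.expect_sum_comm]
          rfl
  have hmain := card_le_of_find_planted hf0 hf1 hg0 hg1 hfg e he0 he1 hfind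
  have hlog : Real.log (Fintype.card L) ≤ C := by
    have hL : Nonempty L := ⟨(hpart (inA fun _ => false) (inB fun _ => false)).choose⟩
    have h1 : Real.log (Fintype.card L) ≤ Real.log (2 ^ C) :=
      Real.log_le_log (by exact_mod_cast Fintype.card_pos) (by exact_mod_cast hcard)
    rw [Real.log_pow] at h1
    have h2 := Real.log_two_lt_d9
    nlinarith [Nat.cast_nonneg (α := ℝ) C]
  rw [Fintype.card_fin] at hmain
  linarith

end TwoCycle

/-! ### The linear lower bound -/

theorem theorem3 :
    ∃ c : ℝ, 0 < c ∧
      ∀ (n : ℕ) [NeZero n], 3 ≤ n →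
      ∀ ε : ℝ, 0 ≤ ε → ε ≤ 1 / (16 * ((4 * n : ℕ) : ℝ) ^ 2) →
      ∀ P : RandomizedProtocol.{w}
          (TwoCycle.Vertex n → TwoCycle.Vertex n → Bool)
          (TwoCycle.Vertex n → TwoCycle.Vertex n → Bool)
          (stdSimplex ℝ (TwoCycle.Vertex n))
          (stdSimplex ℝ (TwoCycle.Vertex n)),
        P.SolvesWithError TwoCycle.IsGame (fun uA uB a b => IsApproxNash ε uA uB a b) (1 / 3) →
        ENNReal.ofReal (c * ((4 * n : ℕ) : ℝ)) ≤ (P.cost TwoCycle.IsGame : ℝ≥0∞) := by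
  refine ⟨1 / 5000, by norm_num, fun n _ hn ε _ hε P hP => ?_⟩
  have : Fact (1 < n) := ⟨by omega⟩
  cases hc : P.cost TwoCycle.IsGame with
  | top => simp
  | coe C =>
    have hC : ∀ uA uB, TwoCycle.IsGame uA uB → ∀ r, P.bits uA uB r ≤ C := by
      intro uA uB h r
      have h1 : (P.bits uA uB r : ℕ∞) ≤ P.cost TwoCycle.IsGame :=
        le_iSup_of_le uA (le_iSup_of_le uB (le_iSup_of_le h
          (le_iSup (fun r => (P.bits uA uB r : ℕ∞)) r)))
      rw [hc] at h1
      exact_mod_cast h1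
    -- For small `n` the linear bound `h2` is void, and `C ≥ 1` absorbs its additive constant: `4 n
    -- ≤ 68 + 4608 C ≤ 4676 C`.
    have h1 : (1 : ℝ) ≤ C := by exact_mod_cast TwoCycle.one_le_of_bits_le hn hε hP hC
    have h2 := TwoCycle.half_le_of_bits_le hε hP hC
    have h3 : (n : ℝ) ≤ 2 * ((n / 2 : ℕ) : ℝ) + 1 := by
      exact_mod_cast (by omega : n ≤ 2 * (n / 2) + 1)
    have h4 : 1 / 5000 * ((4 * n : ℕ) : ℝ) ≤ C := by
      push_cast
      linarith
    calc ENNReal.ofReal (1 / 5000 * ((4 * n : ℕ) : ℝ)) ≤ ENNReal.ofReal C :=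
          ENNReal.ofReal_le_ofReal h4
      _ = ((C : ℕ∞) : ℝ≥0∞) := by simp
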